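/- Let $H$ be a separable, infinite-dimensional real or complex Hilbert space, and let $A$ be a positive bounded operator on $H$ (that is, $A$ is self-adjoint and $\langle Ax,x\rangle\ge 0$ for all $x\in H$; $A$ need not be invertible). Suppose that its essential norm $$\|A\|_{ess}:=\inf\{\|A-K\| : K \text{ a compact operator on } H\}$$ satisfies $\|A\|_{ess}>1$. Then $A$ has a projection decomposition: there is a finite or infinite sequence of (not necessarily mutually orthogonal) self-adjoint projections $P_i$ on $H$ such that $A=\sum_i P_i$, where, if the sequence is infinite, the series converges in the strong operator topology, i.e. $\sum_{i\le n}P_ix\to Ax$ for every $x\in H$. -/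

import Mathlib

open Filter Topology

noncomputable section

/-- The essential norm of a bounded operator: the infimum of `‖B - K‖` over all compact
operators `K`. -/
def essNorm {𝕜 H : Type*} [RCLike 𝕜] [NormedAddCommGroup H] [InnerProductSpace 𝕜 H]
    (B : H →L[𝕜] H) : ℝ :=
  ⨅ K : {K : H →L[𝕜] H // IsCompactOperator K}, ‖B - K‖

/-- The series `∑ P i` converges to `A` in the strong operator topology, i.e. its partial sums
converge to `A` in the topology of pointwise convergence on `H`. -/
def SumsStronglyTo {𝕜 H : Type*} [RCLike 𝕜] [NormedAddCommGroup H] [InnerProductSpace 𝕜 H]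
    (P : ℕ → H →L[𝕜] H) (A : H →L[𝕜] H) : Prop :=
  Tendsto
    (fun n : ℕ => ContinuousLinearMap.toPointwiseConvergenceCLM 𝕜 (RingHom.id 𝕜) H H
      (∑ i ∈ Finset.range n, P i))
    atTop (𝓝 (ContinuousLinearMap.toPointwiseConvergenceCLM 𝕜 (RingHom.id 𝕜) H H A))

/-- `A` has a projection decomposition if it is the sum of a finite or infinite sequence of
(not necessarily mutually orthogonal) self-adjoint projections, an infinite sum being understood
in the strong operator topology. -/
def HasProjectionDecomposition {𝕜 H : Type*} [RCLike 𝕜] [NormedAddCommGroup H]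
    [InnerProductSpace 𝕜 H] [CompleteSpace H] (A : H →L[𝕜] H) : Prop :=
  (∃ (n : ℕ) (P : Fin n → H →L[𝕜] H), (∀ i, IsStarProjection (P i)) ∧ A = ∑ i, P i) ∨
  (∃ P : ℕ → H →L[𝕜] H, (∀ i, IsStarProjection (P i)) ∧ SumsStronglyTo P A)

end

/-! Split off projections `P₀, P₁, …` greedily, keeping the remainder `R = A - P₀ - ⋯ - Pₙ`
positive. The projection onto the span of `R y` lies below `R` as soon as `⟪R y, y⟫ ≤ ‖R y‖²`. Given
`x`, such a `y` is `x + u`, where `u` is orthogonal to `R x` and `R² x`, so that `‖R y‖²` and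
`⟪R y, y⟫` are sums of the contributions of `x` and `u`, and `R` stretches `u` by a factor larger
than `1`; such a `u` exists because finite rank perturbations do not change the essential norm.
Removing this projection decreases `⟪R x, x⟫` by a fixed proportion. Hence, if every term of a dense
sequence is treated infinitely often, the forms `⟪R x, x⟫` tend to `0` on a dense set, and the
remainders, being bounded by `‖A‖`, tend strongly to `0`. -/

section ProjectionDecomposition

open RCLike (re)
open scoped InnerProductSpace

variable {𝕜 H : Type*} [RCLike 𝕜] [NormedAddCommGroup H] [InnerProductSpace 𝕜 H]
  {A R S : H →L[𝕜] H}

theorem norm_inner_apply_sq_le (hR : R.IsPositive) (x y : H) :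
    ‖⟪R x, y⟫_𝕜‖ ^ 2 ≤ re ⟪R x, x⟫_𝕜 * re ⟪R y, y⟫_𝕜 := by
  let core : PreInnerProductSpace.Core 𝕜 H :=
    { inner := fun x y => ⟪R x, y⟫_𝕜
      conj_inner_symm := fun x y => by rw [inner_conj_symm, hR.inner_left_eq_inner_right]
      re_inner_nonneg := hR.re_inner_nonneg_left
      add_left := fun x y z => by rw [map_add, inner_add_left]
      smul_left := fun x y r => by rw [map_smul, inner_smul_left] }
  have cauchy_schwarz : ‖⟪R x, y⟫_𝕜‖ * ‖⟪R y, x⟫_𝕜‖ ≤ re ⟪R x, x⟫_𝕜 * re ⟪R y, y⟫_𝕜 :=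
    InnerProductSpace.Core.inner_mul_inner_self_le (c := core) x y
  rwa [hR.inner_left_eq_inner_right y x, norm_inner_symm y (R x), ← sq] at cauchy_schwarz

theorem norm_apply_sq_le_opNorm_mul_re_inner (hR : R.IsPositive) (x : H) :
    ‖R x‖ ^ 2 ≤ ‖R‖ * re ⟪R x, x⟫_𝕜 := by
  rcases (sq_nonneg ‖R x‖).eq_or_lt with h0 | hpos
  · rw [← h0]
    exact mul_nonneg (norm_nonneg R) (hR.re_inner_nonneg_left x)
  refine le_of_mul_le_mul_right ?_ hpos
  calc ‖R x‖ ^ 2 * ‖R x‖ ^ 2 = ‖⟪R x, R x⟫_𝕜‖ ^ 2 := by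
        rw [inner_self_eq_norm_sq_to_K, norm_pow, RCLike.norm_ofReal, abs_norm, sq (‖R x‖ ^ 2)]
    _ ≤ re ⟪R x, x⟫_𝕜 * re ⟪R (R x), R x⟫_𝕜 := norm_inner_apply_sq_le hR x (R x)
    _ ≤ re ⟪R x, x⟫_𝕜 * (‖R‖ * ‖R x‖ * ‖R x‖) := by
        gcongr
        · exact hR.re_inner_nonneg_left x
        · exact (re_inner_le_norm _ _).trans (by gcongr; exact R.le_opNorm _)
    _ = ‖R‖ * re ⟪R x, x⟫_𝕜 * ‖R x‖ ^ 2 := by ring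

theorem re_inner_apply_le_of_le (hSR : S ≤ R) (x : H) : re ⟪S x, x⟫_𝕜 ≤ re ⟪R x, x⟫_𝕜 := by
  have := ((ContinuousLinearMap.le_def S R).1 hSR).re_inner_nonneg_left x
  rwa [sub_apply, inner_sub_left, map_sub, sub_nonneg] at this

theorem opNorm_le_opNorm_of_le (hS : S.IsPositive) (hSR : S ≤ R) : ‖S‖ ≤ ‖R‖ := by
  rw [S.norm_eq_iSup_rayleighQuotient hS.isSymmetric]
  refine ciSup_le fun x => le_trans ?_ (R.rayleighQuotient_le_norm x)
  refine abs_le_abs_of_nonneg ?_ ?_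
  · exact div_nonneg (hS.re_inner_nonneg_left x) (sq_nonneg _)
  · exact div_le_div_of_nonneg_right (re_inner_apply_le_of_le hSR x) (sq_nonneg _)

theorem essNorm_le_norm (B : H →L[𝕜] H) : essNorm B ≤ ‖B‖ := by
  have hbdd : BddBelow (Set.range fun K : {K : H →L[𝕜] H // IsCompactOperator K} => ‖B - K‖) :=
    ⟨0, Set.forall_mem_range.2 fun _ => norm_nonneg _⟩
  simpa only [essNorm, sub_zero] using ciInf_le hbdd ⟨0, isCompactOperator_zero⟩

theorem essNorm_sub_of_isCompactOperator (B : H →L[𝕜] H) {K : H →L[𝕜] H}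
    (hK : IsCompactOperator K) : essNorm (B - K) = essNorm B :=
  (Equiv.addRight (⟨K, hK⟩ : compactOperator (RingHom.id 𝕜) H H)).iInf_congr fun L => by
    change ‖B - (L + K)‖ = ‖B - K - L‖
    rw [sub_sub, add_comm]

theorem isCompactOperator_starProjection (F : Submodule 𝕜 H) [FiniteDimensional 𝕜 F] :
    IsCompactOperator F.starProjection :=
  (isCompactOperator_of_locallyCompactSpace_dom F.orthogonalProjectionOnto).clm_comp F.subtypeL

theorem exists_mem_orthogonal_mul_norm_lt_norm_apply {c : ℝ} (hc : 0 ≤ c) (hess : c < essNorm A)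
    (F : Submodule 𝕜 H) [FiniteDimensional 𝕜 F] : ∃ z ∈ Fᗮ, c * ‖z‖ < ‖A z‖ := by
  by_contra! hle
  refine hess.not_ge ?_
  calc essNorm A = essNorm (A - A ∘L F.starProjection) :=
        (essNorm_sub_of_isCompactOperator A ((isCompactOperator_starProjection F).clm_comp A)).symm
    _ ≤ ‖A - A ∘L F.starProjection‖ := essNorm_le_norm _
    _ = ‖A ∘L Fᗮ.starProjection‖ := by
        rw [Submodule.starProjection_orthogonal, ContinuousLinearMap.comp_sub,
          ContinuousLinearMap.comp_id]
    _ ≤ c := ContinuousLinearMap.opNorm_le_bound _ hc fun x =>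
        (hle _ (Submodule.starProjection_apply_mem _ x)).trans
          (by gcongr; exact Submodule.norm_starProjection_apply_le _ x)

theorem exists_mem_orthogonal_norm_apply_eq {c r : ℝ} (hc : 0 ≤ c) (hess : c < essNorm A)
    (hr : 0 ≤ r) (F : Submodule 𝕜 H) [FiniteDimensional 𝕜 F] :
    ∃ u ∈ Fᗮ, ‖A u‖ = r ∧ c * ‖u‖ ≤ ‖A u‖ := by
  obtain ⟨z, hzF, hz⟩ := exists_mem_orthogonal_mul_norm_lt_norm_apply hc hess F
  have hAz : 0 < ‖A z‖ := (by positivity : 0 ≤ c * ‖z‖).trans_lt hz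
  have hscale : ‖((r / ‖A z‖ : ℝ) : 𝕜)‖ = r / ‖A z‖ := RCLike.norm_of_nonneg (by positivity)
  refine ⟨((r / ‖A z‖ : ℝ) : 𝕜) • z, Fᗮ.smul_mem _ hzF, ?_, ?_⟩
  · rw [map_smul, norm_smul, hscale, div_mul_cancel₀ _ hAz.ne']
  · rw [map_smul, norm_smul, norm_smul, hscale, mul_left_comm]
    gcongr

theorem norm_inner_sq_eq_norm_sq_mul_re_inner_starProjection (v z : H) :
    ‖⟪v, z⟫_𝕜‖ ^ 2 = ‖v‖ ^ 2 * re ⟪(𝕜 ∙ v).starProjection z, z⟫_𝕜 := by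
  rw [← RCLike.re_ofReal_mul, ← RCLike.conj_ofReal, ← inner_smul_left,
    Submodule.smul_starProjection_singleton, inner_smul_left, RCLike.conj_mul]
  norm_cast

theorem starProjection_span_singleton_apply_le (hR : R.IsPositive) {y : H}
    (hy : re ⟪R y, y⟫_𝕜 ≤ ‖R y‖ ^ 2) : (𝕜 ∙ R y).starProjection ≤ R := by
  rcases eq_or_ne (R y) 0 with h0 | h0
  · simpa [h0, Submodule.span_zero_singleton, ContinuousLinearMap.nonneg_iff_isPositive] using hR
  refine ⟨hR.isSymmetric.sub (Submodule.starProjection_isSymmetric _), fun z => ?_⟩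
  suffices ‖R y‖ ^ 2 * re ⟪(𝕜 ∙ R y).starProjection z, z⟫_𝕜 ≤ ‖R y‖ ^ 2 * re ⟪R z, z⟫_𝕜 by
    have := le_of_mul_le_mul_left this (by positivity)
    simpa [ContinuousLinearMap.reApplyInnerSelf, inner_sub_left] using this
  calc ‖R y‖ ^ 2 * re ⟪(𝕜 ∙ R y).starProjection z, z⟫_𝕜 = ‖⟪R y, z⟫_𝕜‖ ^ 2 :=
        (norm_inner_sq_eq_norm_sq_mul_re_inner_starProjection _ z).symm
    _ ≤ re ⟪R y, y⟫_𝕜 * re ⟪R z, z⟫_𝕜 := norm_inner_apply_sq_le hR y z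
    _ ≤ ‖R y‖ ^ 2 * re ⟪R z, z⟫_𝕜 := by gcongr; exact hR.re_inner_nonneg_left z

theorem exists_inner_eq_zero_norm_apply_sq_eq (hR : R.IsPositive) {c s : ℝ} (hc : 0 ≤ c)
    (hess : c < essNorm R) (hs : 0 ≤ s) (x : H) :
    ∃ u, ⟪R x, u⟫_𝕜 = 0 ∧ ⟪R x, R u⟫_𝕜 = 0 ∧ ‖R u‖ ^ 2 = s ∧ c * re ⟪R u, u⟫_𝕜 ≤ s := by
  obtain ⟨u, hu, hRu, hcu⟩ := exists_mem_orthogonal_norm_apply_eq hc hess (Real.sqrt_nonneg s)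
    (𝕜 ∙ R x ⊔ 𝕜 ∙ R (R x))
  rw [← Submodule.inf_orthogonal] at hu
  have norm_sq : ‖R u‖ ^ 2 = s := by rw [hRu, Real.sq_sqrt hs]
  refine ⟨u, Submodule.mem_orthogonal_singleton_iff_inner_right.1 hu.1, ?_, norm_sq, ?_⟩
  · rw [← hR.inner_left_eq_inner_right]
    exact Submodule.mem_orthogonal_singleton_iff_inner_right.1 hu.2
  · calc c * re ⟪R u, u⟫_𝕜 ≤ c * (‖R u‖ * ‖u‖) := by gcongr; exact re_inner_le_norm _ _
      _ = ‖R u‖ * (c * ‖u‖) := by ring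
      _ ≤ ‖R u‖ * ‖R u‖ := by gcongr
      _ = s := by rw [← sq, norm_sq]

theorem exists_re_inner_apply_le_norm_apply_sq (hR : R.IsPositive) {c : ℝ} (hc : 1 < c)
    (hess : c < essNorm R) (x : H) :
    ∃ y, ⟪R y, x⟫_𝕜 = ⟪R x, x⟫_𝕜 ∧ re ⟪R y, y⟫_𝕜 ≤ ‖R y‖ ^ 2 ∧
      ‖R y‖ ^ 2 ≤ (‖R‖ + c / (c - 1)) * re ⟪R x, x⟫_𝕜 := by
  have hc1 : 0 < c - 1 := sub_pos.2 hc
  have hq := hR.re_inner_nonneg_left x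
  -- The value `s` of `‖R u‖ ^ 2` solves `⟪R x, x⟫ + s / c = s`: then `⟪R y, y⟫ ≤ s ≤ ‖R y‖ ^ 2`.
  obtain ⟨u, hxu, hRxRu, norm_sq_u, form_u⟩ := exists_inner_eq_zero_norm_apply_sq_eq hR
    (by positivity) hess (by positivity : 0 ≤ c / (c - 1) * re ⟪R x, x⟫_𝕜) x
  have hux : ⟪R u, x⟫_𝕜 = 0 := by rwa [hR.inner_left_eq_inner_right, inner_eq_zero_symm]
  have norm_sq_add : ‖R (x + u)‖ ^ 2 = ‖R x‖ ^ 2 + ‖R u‖ ^ 2 := by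
    simpa only [map_add, sq] using norm_add_sq_eq_norm_sq_add_norm_sq_of_inner_eq_zero _ _ hRxRu
  have form_add : re ⟪R (x + u), x + u⟫_𝕜 = re ⟪R x, x⟫_𝕜 + re ⟪R u, u⟫_𝕜 := by
    simp only [map_add, inner_add_left, inner_add_right, hxu, hux, add_zero, zero_add]
  refine ⟨x + u, by rw [map_add, inner_add_left, hux, add_zero], ?_, ?_⟩
  · calc re ⟪R (x + u), x + u⟫_𝕜 ≤ re ⟪R x, x⟫_𝕜 + c / (c - 1) * re ⟪R x, x⟫_𝕜 / c := by
          rw [form_add]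
          gcongr
          rwa [le_div_iff₀' (by positivity)]
      _ = ‖R u‖ ^ 2 := by rw [norm_sq_u]; field_simp; ring
      _ ≤ ‖R (x + u)‖ ^ 2 := by rw [norm_sq_add]; exact le_add_of_nonneg_left (sq_nonneg _)
  · rw [norm_sq_add, norm_sq_u, add_mul]
    gcongr
    exact norm_apply_sq_le_opNorm_mul_re_inner hR x

theorem exists_isStarProjection_le [CompleteSpace H] (hR : R.IsPositive) {c : ℝ} (hc : 1 < c)
    (hess : c < essNorm R) (x : H) :
    ∃ P : H →L[𝕜] H, IsStarProjection P ∧ IsCompactOperator P ∧ P ≤ R ∧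
      re ⟪R x, x⟫_𝕜 ≤ (‖R‖ + c / (c - 1)) * re ⟪P x, x⟫_𝕜 := by
  obtain ⟨y, hyx, hy, hyK⟩ := exists_re_inner_apply_le_norm_apply_sq hR hc hess x
  set P := (𝕜 ∙ R y).starProjection
  have hP : IsStarProjection P := isStarProjection_starProjection
  have hPx := (ContinuousLinearMap.IsPositive.of_isStarProjection hP).re_inner_nonneg_left x
  refine ⟨P, hP, isCompactOperator_starProjection _,
    starProjection_span_singleton_apply_le hR hy, ?_⟩
  rcases (hR.re_inner_nonneg_left x).eq_or_lt with h0 | hpos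
  · rw [← h0]
    have := sub_pos.2 hc
    positivity
  refine le_of_mul_le_mul_left ?_ hpos
  calc re ⟪R x, x⟫_𝕜 * re ⟪R x, x⟫_𝕜 ≤ ‖⟪R y, x⟫_𝕜‖ ^ 2 := by
        rw [hyx, sq]
        gcongr <;> exact RCLike.re_le_norm _
    _ = ‖R y‖ ^ 2 * re ⟪P x, x⟫_𝕜 := norm_inner_sq_eq_norm_sq_mul_re_inner_starProjection _ x
    _ ≤ (‖R‖ + c / (c - 1)) * re ⟪R x, x⟫_𝕜 * re ⟪P x, x⟫_𝕜 := by gcongr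
    _ = re ⟪R x, x⟫_𝕜 * ((‖R‖ + c / (c - 1)) * re ⟪P x, x⟫_𝕜) := by ring

theorem exists_seq_of_forall_exists {α ι : Type*} {p : α → Prop} {r : ι → α → α → Prop}
    (step : ∀ a, p a → ∀ i, ∃ b, p b ∧ r i a b) {a₀ : α} (h₀ : p a₀) (i : ℕ → ι) :
    ∃ a : ℕ → α, a 0 = a₀ ∧ ∀ n, p (a n) ∧ r (i n) (a n) (a (n + 1)) := by
  choose next hp hr using step
  let a : ℕ → {a // p a} := fun n => n.rec ⟨a₀, h₀⟩ fun n a => ⟨next a a.2 (i n), hp _ _ _⟩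
  exact ⟨fun n => (a n).1, rfl, fun n => ⟨(a n).2, hr (a n).1 (a n).2 (i n)⟩⟩

theorem exists_seq_isStarProjection_sub_succ [CompleteSpace H] (hA : A.IsPositive)
    (hess : 1 < essNorm A) (x : ℕ → H) :
    ∃ (K : ℝ) (R : ℕ → H →L[𝕜] H), R 0 = A ∧ ∀ n, (R n).IsPositive ∧ ‖R n‖ ≤ ‖A‖ ∧
      IsStarProjection (R n - R (n + 1)) ∧
      re ⟪R n (x n), x n⟫_𝕜 ≤ K * re ⟪(R n - R (n + 1)) (x n), x n⟫_𝕜 := by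
  obtain ⟨c, hc, hcA⟩ := exists_between hess
  have step : ∀ R : H →L[𝕜] H, R.IsPositive ∧ ‖R‖ ≤ ‖A‖ ∧ c < essNorm R → ∀ x : H,
      ∃ R' : H →L[𝕜] H, (R'.IsPositive ∧ ‖R'‖ ≤ ‖A‖ ∧ c < essNorm R') ∧
        IsStarProjection (R - R') ∧
        re ⟪R x, x⟫_𝕜 ≤ (‖A‖ + c / (c - 1)) * re ⟪(R - R') x, x⟫_𝕜 := by
    rintro R ⟨hR, hRA, hcR⟩ x
    obtain ⟨P, hP, hPcomp, hPR, hPx⟩ := exists_isStarProjection_le hR hc hcR x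
    have hPpos := ContinuousLinearMap.IsPositive.of_isStarProjection hP
    have hsub : R - P ≤ R := by rwa [ContinuousLinearMap.le_def, sub_sub_cancel]
    refine ⟨R - P, ⟨hPR, (opNorm_le_opNorm_of_le hPR hsub).trans hRA, ?_⟩, ?_, ?_⟩
    · rwa [essNorm_sub_of_isCompactOperator R hPcomp]
    · rwa [sub_sub_cancel]
    · rw [sub_sub_cancel]
      refine hPx.trans ?_
      gcongr
      exact hPpos.re_inner_nonneg_left x
  obtain ⟨R, hR0, hR⟩ := exists_seq_of_forall_exists step ⟨hA, le_rfl, hcA⟩ x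
  refine ⟨‖A‖ + c / (c - 1), R, hR0, fun n => ?_⟩
  obtain ⟨⟨hpos, hnorm, -⟩, hstep⟩ := hR n
  exact ⟨hpos, hnorm, hstep⟩

theorem tendsto_zero_of_antitone_of_frequently_le_mul_sub {u : ℕ → ℝ} {K : ℝ} (hu : Antitone u)
    (h0 : ∀ n, 0 ≤ u n) (h : ∃ᶠ n in atTop, u n ≤ K * (u n - u (n + 1))) :
    Tendsto u atTop (𝓝 0) := by
  have hlim := tendsto_atTop_ciInf hu ⟨(0 : ℝ), Set.forall_mem_range.2 h0⟩
  set l := ⨅ n, u n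
  have hdiff : Tendsto (fun n => u n - K * (u n - u (n + 1))) atTop (𝓝 (l - K * (l - l))) :=
    hlim.sub ((hlim.sub (hlim.comp (tendsto_add_atTop_nat 1))).const_mul K)
  have hl : l ≤ 0 := by
    simpa using le_of_tendsto_of_frequently hdiff (h.mono fun _ => sub_nonpos.2)
  rwa [hl.antisymm (le_ciInf h0 : 0 ≤ l)] at hlim

theorem frequently_unpair_fst_eq (k : ℕ) : ∃ᶠ n : ℕ in atTop, n.unpair.1 = k :=
  frequently_atTop.2 fun N => ⟨Nat.pair k N, Nat.right_le_pair k N, by rw [Nat.unpair_pair]⟩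

theorem tendsto_apply_zero_of_tendsto_re_inner {ι : Type*} {l : Filter ι} {R : ι → H →L[𝕜] H}
    {M : ℝ} (hR : ∀ i, (R i).IsPositive) (hM : ∀ i, ‖R i‖ ≤ M) {x : H}
    (hx : Tendsto (fun i => re ⟪R i x, x⟫_𝕜) l (𝓝 0)) : Tendsto (fun i => R i x) l (𝓝 0) := by
  have hsq : Tendsto (fun i => ‖R i x‖ ^ 2) l (𝓝 0) := by
    refine squeeze_zero (fun i => sq_nonneg _) (fun i => ?_) (by simpa using hx.const_mul M)
    exact (norm_apply_sq_le_opNorm_mul_re_inner (hR i) x).trans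
      (mul_le_mul_of_nonneg_right (hM i) ((hR i).re_inner_nonneg_left x))
  rw [tendsto_zero_iff_norm_tendsto_zero]
  simpa using hsq.sqrt

theorem tendsto_apply_zero_of_denseRange {𝕂 E F ι κ : Type*} [NontriviallyNormedField 𝕂]
    [SeminormedAddCommGroup E] [NormedSpace 𝕂 E] [SeminormedAddCommGroup F] [NormedSpace 𝕂 F]
    {l : Filter ι} {T : ι → E →L[𝕂] F} {M : ℝ} (hM : ∀ i, ‖T i‖ ≤ M) {d : κ → E}
    (hd : DenseRange d) (h : ∀ k, Tendsto (fun i => T i (d k)) l (𝓝 0)) (x : E) :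
    Tendsto (fun i => T i x) l (𝓝 0) := by
  have hequi : Equicontinuous ((↑) ∘ T : ι → E → F) :=
    ((NormedSpace.equicontinuous_TFAE T).out 5 1 : (∃ C, ∀ i, ‖T i‖ ≤ C) ↔ _).1 ⟨M, hM⟩
  exact (hequi.isClosed_setOfPred_tendsto continuous_const).closure_subset_iff.2
    (Set.range_subset_iff.2 h) (hd x)

theorem sumsStronglyTo_sub_succ {R : ℕ → H →L[𝕜] H}
    (hR : ∀ x, Tendsto (fun n => R n x) atTop (𝓝 0)) :
    SumsStronglyTo (fun n => R n - R (n + 1)) (R 0) := by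
  rw [SumsStronglyTo, PointwiseConvergenceCLM.tendsto_iff_forall_tendsto]
  intro x
  simpa only [Finset.sum_range_sub', sub_zero] using! (hR x).const_sub (R 0 x)

end ProjectionDecomposition

theorem theorem2 {𝕜 H : Type*} [RCLike 𝕜] [NormedAddCommGroup H] [InnerProductSpace 𝕜 H]
    [CompleteSpace H] [TopologicalSpace.SeparableSpace H]
    (hdim : ¬ FiniteDimensional 𝕜 H)
    (A : H →L[𝕜] H) (hA : A.IsPositive) (hess : 1 < essNorm A) :
    HasProjectionDecomposition A := by
  let d := TopologicalSpace.denseSeq H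
  obtain ⟨K, R, rfl, hR⟩ := exists_seq_isStarProjection_sub_succ hA hess fun n => d n.unpair.1
  choose hpos hnorm hproj hdec using hR
  refine .inr ⟨fun n => R n - R (n + 1), hproj, sumsStronglyTo_sub_succ ?_⟩
  refine tendsto_apply_zero_of_denseRange hnorm (TopologicalSpace.denseRange_denseSeq H) fun k => ?_
  refine tendsto_apply_zero_of_tendsto_re_inner hpos hnorm ?_
  have hanti : Antitone R := antitone_nat_of_succ_le fun n =>
    ContinuousLinearMap.IsPositive.of_isStarProjection (hproj n)
  refine tendsto_zero_of_antitone_of_frequently_le_mul_sub (K := K)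
    (fun m n hmn => re_inner_apply_le_of_le (hanti hmn) (d k))
    (fun n => (hpos n).re_inner_nonneg_left (d k))
    ((frequently_unpair_fst_eq k).mono fun n hn => ?_)
  simpa only [hn, sub_apply, inner_sub_left, map_sub] using hdec n
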